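/- All graphs are finite and simple. Let $G$ be a graph with a perfect matching. A set $S\subseteq E(G)$ is a global forcing set of $G$ if no two distinct perfect matchings $M,M'$ of $G$ satisfy $M\cap S=M'\cap S$; let $gf(G)$ be the minimum cardinality of a global forcing set of $G$. For a perfect matching $M$ of $G$, let $af(G,M)$ be the minimum cardinality of a set $S\subseteq E(G)\setminus M$ such that $G-S$ has exactly one perfect matching, and let $Af(G)$ be the maximum of $af(G,M)$ over all perfect matchings $M$ of $G$. **Theorem.** Let $G$ be a connected graph with a perfect matching and $2n\ge 4$ vertices. Then $$-\tfrac12(n^2-n-2)\;\le\; gf(G)-Af(G)\;\le\;(n-1)(n-2),$$ and equality holds in the left inequality if and only if $n=2$. -/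

import Mathlib

namespace PerfectMatchingForcing

variable {V : Type*}

/-- `S` is a global forcing set of `G`: a set of edges of `G` on which no two distinct perfect
matchings of `G` coincide. -/
def IsGlobalForcingSet (G : SimpleGraph V) (S : Set (Sym2 V)) : Prop :=
  S ⊆ G.edgeSet ∧
    ∀ M M' : G.Subgraph, M.IsPerfectMatching → M'.IsPerfectMatching →
      M.edgeSet ∩ S = M'.edgeSet ∩ S → M = M'

/-- The global forcing number `gf(G)`: the minimum cardinality of a global forcing set of `G`
(for finite `G`, where `E(G)` itself is a global forcing set). -/
noncomputable def globalForcingNumber (G : SimpleGraph V) : ℕ :=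
  sInf {k : ℕ | ∃ S : Set (Sym2 V), IsGlobalForcingSet G S ∧ S.ncard = k}

/-- `S` is an anti-forcing set of `M` in `G`: a set of edges of `G` outside `M` whose removal
results in a graph with a unique perfect matching. -/
def IsAntiForcingSet (G : SimpleGraph V) (M : G.Subgraph) (S : Set (Sym2 V)) : Prop :=
  S ⊆ G.edgeSet \ M.edgeSet ∧ ∃! N : (G.deleteEdges S).Subgraph, N.IsPerfectMatching

/-- The anti-forcing number `af(G, M)` of a perfect matching `M`: the minimum cardinality of an
anti-forcing set of `M` (for finite `G`, where `E(G) \ M` itself is an anti-forcing set). -/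
noncomputable def antiForcingNumber (G : SimpleGraph V) (M : G.Subgraph) : ℕ :=
  sInf {k : ℕ | ∃ S : Set (Sym2 V), IsAntiForcingSet G M S ∧ S.ncard = k}

/-- The maximum anti-forcing number `Af(G)`: the maximum of `af(G, M)` over all perfect matchings
`M` of `G` (a maximum over a finite nonempty set when `G` is finite and has a perfect matching). -/
noncomputable def maxAntiForcingNumber (G : SimpleGraph V) : ℕ :=
  sSup {k : ℕ | ∃ M : G.Subgraph, M.IsPerfectMatching ∧ antiForcingNumber G M = k}

end PerfectMatchingForcing

/-!
Perfect matchings are encoded as involutions `σ` with `v` adjacent to `σ v`. A global forcing set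
is the complement of a *rigid* subgraph `T` of `G`: two perfect matchings that differ only by edges
of `T` are equal (`IsRigid`). An anti-forcing set of `M` is the complement of a subgraph `H` whose
only perfect matching is `M` (`IsUniqueMate`). So, with `m = |E(G)|`, one compares the largest
number of edges `m - gf(G)` of a rigid `T` with the largest number of edges `m - af(G, M)` of `H`.

Lower bound. Choose the perfect matching with the most edges in a rigid `T`. No two edges of it are
joined by two disjoint edges of `T`, since a switch along the alternating 4-cycle would contradict
the choice or the rigidity (`IsRigid.exists_noSwitch`). Hence `T` has at most two edges between
any two matching edges, and `|E(T)| ≤ n ^ 2`, that is, `m ≤ n ^ 2 + gf(G)`. Ordering the edges of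
`M` shows that at most half of the edges outside `M` need to be removed to make `M` unique
(`two_mul_antiForcingNumber_add_le`). Together these give the strict inequality when `n ≥ 3` and
`gf(G) ≥ 3`. If `gf(G) ≤ 2` then `G` has at most `2 ^ gf(G)` perfect matchings, which bounds `Af(G)`
directly (`antiForcingNumber_lt_two_pow`); this also covers `n = 2`.

Upper bound. Let `H` be a largest subgraph whose only perfect matching is `M`. Two edges of `M` are
joined by at most two edges of `H`, and two such edges together with one of the edges of `M` form a
triangle, whose apex lies on the other edge of `M`. Orient each such pair from apex to base, and
take a minimum set `R` of roots from which all edges of `M` are reached (`exists_roots`). No two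
roots are joined by a triangle, so `|E(H)| ≤ n ^ 2 - |R| (|R| - 1) / 2 ≤ n ^ 2 - (|R| - 1)`
(`NoSwitch.two_mul_ncard_edgeSet_add_le`). The branching of triangles from the roots is rigid
(`IsTriangleBranching.isRigid`), and since `G` is connected it extends to a connected spanning rigid
subgraph `T`: adding a bridge preserves rigidity, by parity (`IsRigid.sup_edge`). As `T` contains
`n - |R|` triangles which can be opened without disconnecting it, `|E(T)| ≥ 3 n - 1 - |R|`
(`IsTriangleBranching.three_mul_le`). Hence
`gf(G) - af(G, M) ≤ |E(H)| - |E(T)| ≤ n ^ 2 - 3 n + 2`.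
-/

namespace PerfectMatchingForcing


/-! ### Perfect matchings as involutions -/

/-- A perfect matching of `G`, encoded as the map `σ` sending each vertex to its partner. Since `G`
has no loops, `σ` is an involution without fixed points. -/
structure IsMate {V : Type*} (G : SimpleGraph V) (σ : V → V) : Prop where
  adj : ∀ v, G.Adj v (σ v)
  invol : ∀ v, σ (σ v) = v

namespace IsMate

variable {V : Type*} {G H : SimpleGraph V} {σ τ : V → V}

theorem ne (h : IsMate G σ) (v : V) : σ v ≠ v := (h.adj v).ne'

theorem mono (h : IsMate G σ) (hGH : G ≤ H) : IsMate H σ := ⟨fun v => hGH (h.adj v), h.invol⟩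

theorem injective (h : IsMate G σ) : Function.Injective σ :=
  Function.LeftInverse.injective h.invol

theorem eq_iff (h : IsMate G σ) {u v : V} : σ u = v ↔ u = σ v :=
  ⟨fun e => by rw [← e, h.invol], fun e => by rw [e, h.invol]⟩

/-- The subgraph of `G` formed by the edges `v — σ v`. -/
def toSubgraph (h : IsMate G σ) : G.Subgraph where
  verts := Set.univ
  Adj u v := σ u = v
  adj_sub := by rintro u v rfl; exact h.adj u
  edge_vert := fun _ => Set.mem_univ _
  symm := ⟨by rintro u v rfl; exact h.invol u⟩

theorem toSubgraph_adj (h : IsMate G σ) {u v : V} : h.toSubgraph.Adj u v ↔ σ u = v := Iff.rfl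

theorem isPerfectMatching (h : IsMate G σ) : h.toSubgraph.IsPerfectMatching := by
  rw [SimpleGraph.Subgraph.isPerfectMatching_iff]
  exact fun v => ⟨σ v, rfl, fun _ hw => Eq.symm hw⟩

end IsMate

variable {V : Type*} {G H T : SimpleGraph V} {σ τ : V → V}

theorem exists_isMate {M : G.Subgraph} (hM : M.IsPerfectMatching) :
    ∃ σ, IsMate G σ ∧ ∀ u v, M.Adj u v ↔ σ u = v := by
  rw [SimpleGraph.Subgraph.isPerfectMatching_iff] at hM
  choose σ h1 h2 using hM
  refine ⟨σ, ⟨fun v => (h1 v).adj_sub, fun v => (h2 _ _ (h1 v).symm).symm⟩, fun u v => ?_⟩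
  exact ⟨fun h => (h2 _ _ h).symm, fun h => h ▸ h1 u⟩

theorem eq_of_adj_iff {M M' : G.Subgraph} (hM : M.IsPerfectMatching) (hM' : M'.IsPerfectMatching)
    (h : ∀ u v, M.Adj u v ↔ M'.Adj u v) : M = M' := by
  refine SimpleGraph.Subgraph.ext ?_ ?_
  · rw [SimpleGraph.Subgraph.isSpanning_iff.1 hM.2, SimpleGraph.Subgraph.isSpanning_iff.1 hM'.2]
  · funext u v
    exact propext (h u v)

/-- `H` has exactly one perfect matching, namely `σ`. -/
def IsUniqueMate (H : SimpleGraph V) (σ : V → V) : Prop :=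
  IsMate H σ ∧ ∀ τ, IsMate H τ → τ = σ

/-- Two perfect matchings of `G` that differ only by edges of `T` are equal. For `T ≤ G` this says
that `E(G) \ E(T)` is a global forcing set, or that `T` contains no cycle along which some
perfect matching of `G` alternates. -/
def IsRigid (G T : SimpleGraph V) : Prop :=
  ∀ σ τ, IsMate G σ → IsMate G τ →
    (∀ u, σ u ≠ τ u → T.Adj u (σ u) ∧ T.Adj u (τ u)) → σ = τ

/-! ### The forcing numbers in terms of the retained edges -/

theorem IsGlobalForcingSet.isRigid {S : Set (Sym2 V)} (hS : IsGlobalForcingSet G S) :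
    IsRigid G (G.deleteEdges S) := by
  intro σ τ hσ hτ h
  have key : hσ.toSubgraph = hτ.toSubgraph := by
    refine hS.2 _ _ hσ.isPerfectMatching hτ.isPerfectMatching ?_
    ext e
    induction e with
    | _ u v =>
    simp only [Set.mem_inter_iff, SimpleGraph.Subgraph.mem_edgeSet, IsMate.toSubgraph_adj]
    refine and_congr_left fun he => ?_
    by_cases hu : σ u = τ u
    · rw [hu]
    · have := h u hu
      simp only [SimpleGraph.deleteEdges_adj] at this
      exact ⟨by rintro rfl; exact absurd he this.1.2, by rintro rfl; exact absurd he this.2.2⟩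
  funext u
  have : hτ.toSubgraph.Adj u (σ u) := by rw [← key]; rfl
  exact Eq.symm this

theorem IsRigid.isGlobalForcingSet (hT : IsRigid G T) :
    IsGlobalForcingSet G (G.edgeSet \ T.edgeSet) := by
  refine ⟨Set.sdiff_subset, fun M M' hM hM' h => ?_⟩
  obtain ⟨σ, hσ, hMσ⟩ := exists_isMate hM
  obtain ⟨τ, hτ, hMτ⟩ := exists_isMate hM'
  have key : ∀ u v, G.Adj u v → ¬ T.Adj u v → (σ u = v ↔ τ u = v) := by
    intro u v h1 h2
    have := Set.ext_iff.1 h s(u, v)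
    simpa [h1, h2, hMσ, hMτ] using this
  have : σ = τ := by
    refine hT σ τ hσ hτ fun u hu => ⟨?_, ?_⟩
    · by_contra hc
      exact hu ((key u _ (hσ.adj u) hc).1 rfl).symm
    · by_contra hc
      exact hu ((key u _ (hτ.adj u) hc).2 rfl)
  subst this
  exact eq_of_adj_iff hM hM' fun u v => (hMσ u v).trans (hMτ u v).symm

theorem isAntiForcingSet_iff {M : G.Subgraph} (hσ : IsMate G σ)
    (hMσ : ∀ u v, M.Adj u v ↔ σ u = v) {S : Set (Sym2 V)} :
    IsAntiForcingSet G M S ↔ S ⊆ G.edgeSet ∧ IsUniqueMate (G.deleteEdges S) σ := by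
  have hsub : S ⊆ G.edgeSet \ M.edgeSet ↔ S ⊆ G.edgeSet ∧ IsMate (G.deleteEdges S) σ := by
    rw [Set.subset_sdiff, Set.disjoint_left]
    refine and_congr_right fun _ => ⟨fun h => ⟨fun v => ?_, hσ.invol⟩, fun h e he hM => ?_⟩
    · rw [SimpleGraph.deleteEdges_adj]
      refine ⟨hσ.adj v, fun hv => h hv ?_⟩
      rw [SimpleGraph.Subgraph.mem_edgeSet, hMσ]
    · induction e with
      | _ u v =>
      rw [SimpleGraph.Subgraph.mem_edgeSet, hMσ] at hM
      subst hM
      exact (SimpleGraph.deleteEdges_adj.1 (h.adj u)).2 he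
  rw [IsAntiForcingSet, hsub, and_assoc]
  refine and_congr_right fun _ => and_congr_right fun hσ' => ⟨fun h τ hτ => ?_, fun h => ?_⟩
  · have key := h.unique hτ.isPerfectMatching hσ'.isPerfectMatching
    funext u
    have : hσ'.toSubgraph.Adj u (τ u) := by rw [← key]; rfl
    exact Eq.symm this
  · refine ⟨hσ'.toSubgraph, hσ'.isPerfectMatching, fun N hN => ?_⟩
    obtain ⟨τ, hτ, hNτ⟩ := exists_isMate hN
    refine eq_of_adj_iff hN hσ'.isPerfectMatching fun u v => ?_
    rw [hNτ, hσ'.toSubgraph_adj, h τ hτ]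

theorem ncard_edgeSet_deleteEdges [Finite V] {S : Set (Sym2 V)} (hS : S ⊆ G.edgeSet) :
    S.ncard + (G.deleteEdges S).edgeSet.ncard = G.edgeSet.ncard := by
  rw [SimpleGraph.edgeSet_deleteEdges, add_comm, Set.ncard_sdiff_add_ncard_of_subset hS]

theorem deleteEdges_edgeSet_diff (hTG : T ≤ G) : G.deleteEdges (G.edgeSet \ T.edgeSet) = T := by
  ext u v
  simp only [SimpleGraph.deleteEdges_adj, Set.mem_sdiff, SimpleGraph.mem_edgeSet]
  have := @hTG u v
  tauto

theorem globalForcingNumber_add_le [Finite V] (hTG : T ≤ G) (hT : IsRigid G T) :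
    globalForcingNumber G + T.edgeSet.ncard ≤ G.edgeSet.ncard := by
  have h1 := ncard_edgeSet_deleteEdges (G := G) (S := G.edgeSet \ T.edgeSet) Set.sdiff_subset
  rw [deleteEdges_edgeSet_diff hTG] at h1
  rw [← h1]
  have h2 : globalForcingNumber G ≤ (G.edgeSet \ T.edgeSet).ncard :=
    Nat.sInf_le ⟨_, hT.isGlobalForcingSet, rfl⟩
  omega

theorem exists_isGlobalForcingSet [Finite V] (G : SimpleGraph V) :
    ∃ S, IsGlobalForcingSet G S ∧ S.ncard = globalForcingNumber G := by
  refine Nat.sInf_mem (s := {k | ∃ S, IsGlobalForcingSet G S ∧ S.ncard = k})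
    ⟨_, _, IsRigid.isGlobalForcingSet (T := ⊥) fun σ τ _ _ h => funext fun u => ?_, rfl⟩
  by_contra hu
  exact (h u hu).1

theorem antiForcingNumber_add_le [Finite V] {M : G.Subgraph} (hσ : IsMate G σ)
    (hMσ : ∀ u v, M.Adj u v ↔ σ u = v) (hHG : H ≤ G) (hH : IsUniqueMate H σ) :
    antiForcingNumber G M + H.edgeSet.ncard ≤ G.edgeSet.ncard := by
  have h1 := ncard_edgeSet_deleteEdges (G := G) (S := G.edgeSet \ H.edgeSet) Set.sdiff_subset
  have h2 : IsAntiForcingSet G M (G.edgeSet \ H.edgeSet) := by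
    rw [isAntiForcingSet_iff hσ hMσ, deleteEdges_edgeSet_diff hHG]
    exact ⟨Set.sdiff_subset, hH⟩
  rw [deleteEdges_edgeSet_diff hHG] at h1
  rw [← h1]
  have h3 : antiForcingNumber G M ≤ (G.edgeSet \ H.edgeSet).ncard := Nat.sInf_le ⟨_, h2, rfl⟩
  omega

/-- The perfect matching itself is a graph with a unique perfect matching, so anti-forcing sets
exist. -/
theorem isUniqueMate_spanningCoe (hσ : IsMate G σ) :
    IsUniqueMate hσ.toSubgraph.spanningCoe σ :=
  ⟨⟨fun _ => rfl, hσ.invol⟩, fun _ hτ => funext fun u => Eq.symm (hτ.adj u)⟩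

theorem exists_isUniqueMate_add_eq [Finite V] {M : G.Subgraph} (hσ : IsMate G σ)
    (hMσ : ∀ u v, M.Adj u v ↔ σ u = v) :
    ∃ H ≤ G, IsUniqueMate H σ ∧
      antiForcingNumber G M + H.edgeSet.ncard = G.edgeSet.ncard := by
  have hne : {k | ∃ S, IsAntiForcingSet G M S ∧ S.ncard = k}.Nonempty := by
    refine ⟨_, _, (isAntiForcingSet_iff hσ hMσ).2
      ⟨Set.sdiff_subset (t := hσ.toSubgraph.spanningCoe.edgeSet), ?_⟩, rfl⟩
    rw [deleteEdges_edgeSet_diff (SimpleGraph.Subgraph.spanningCoe_le _)]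
    exact isUniqueMate_spanningCoe hσ
  obtain ⟨S, hS, hc⟩ := Nat.sInf_mem hne
  have hS' := (isAntiForcingSet_iff hσ hMσ).1 hS
  refine ⟨_, SimpleGraph.deleteEdges_le S, hS'.2, ?_⟩
  rw [← ncard_edgeSet_deleteEdges hS'.1, hc]
  rfl

theorem bddAbove_antiForcingNumber [Finite V] (G : SimpleGraph V) :
    BddAbove {k | ∃ M : G.Subgraph, M.IsPerfectMatching ∧ antiForcingNumber G M = k} := by
  refine ⟨G.edgeSet.ncard, ?_⟩
  rintro _ ⟨M, hM, rfl⟩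
  obtain ⟨σ, hσ, hMσ⟩ := exists_isMate hM
  obtain ⟨H, -, -, h⟩ := exists_isUniqueMate_add_eq hσ hMσ
  omega

theorem antiForcingNumber_le_max [Finite V] {M : G.Subgraph} (hM : M.IsPerfectMatching) :
    antiForcingNumber G M ≤ maxAntiForcingNumber G :=
  le_csSup (bddAbove_antiForcingNumber G) ⟨M, hM, rfl⟩

theorem exists_antiForcingNumber_eq_max [Finite V] (hpm : ∃ M : G.Subgraph, M.IsPerfectMatching) :
    ∃ M : G.Subgraph, M.IsPerfectMatching ∧ antiForcingNumber G M = maxAntiForcingNumber G := by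
  obtain ⟨M, hM⟩ := hpm
  exact Nat.sSup_mem (s := {k | ∃ M : G.Subgraph, M.IsPerfectMatching ∧ antiForcingNumber G M = k})
    ⟨_, M, hM, rfl⟩ (bddAbove_antiForcingNumber G)

/-! ### Switching along alternating 4-cycles -/

open scoped Classical in
/-- The map obtained from `σ` by exchanging the pairs `u — σ u`, `v — σ v` for `u — v`,
`σ u — σ v`. -/
noncomputable def switch (σ : V → V) (u v w : V) : V :=
  if w = u then v else if w = v then u else if w = σ u then σ v else if w = σ v then σ u else σ w

theorem IsMate.switch {u v : V} (hσ : IsMate G σ) (huv : G.Adj u v) (hv : v ≠ σ u)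
    (hσuv : G.Adj (σ u) (σ v)) : IsMate G (switch σ u v) := by
  have h1 := hσ.ne u
  have h2 := hσ.ne v
  have h3 : σ u ≠ σ v := hσuv.ne
  have h4 : u ≠ v := huv.ne
  have h5 : u ≠ σ v := fun h => hv (by rw [h, hσ.invol])
  refine ⟨fun w => ?_, fun w => ?_⟩
  · unfold PerfectMatchingForcing.switch
    split_ifs with a b c d
    · rwa [a]
    · rw [b]; exact huv.symm
    · rwa [c]
    · rw [d]; exact hσuv.symm
    · exact hσ.adj w
  · by_cases a : w = u
    · simp [PerfectMatchingForcing.switch, a, h4.symm]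
    by_cases b : w = v
    · simp [PerfectMatchingForcing.switch, b, h4.symm]
    by_cases c : w = σ u
    · simp [PerfectMatchingForcing.switch, c, h1, hv.symm, h3.symm, h5.symm, h2]
    by_cases d : w = σ v
    · simp [PerfectMatchingForcing.switch, d, h1, hv.symm, h3.symm, h5.symm, h2]
    have e1 : σ w ≠ u := fun h => c (by rw [← h, hσ.invol])
    have e2 : σ w ≠ v := fun h => d (by rw [← h, hσ.invol])
    have e3 : σ w ≠ σ u := fun h => a (hσ.injective h)
    have e4 : σ w ≠ σ v := fun h => b (hσ.injective h)
    simp [PerfectMatchingForcing.switch, a, b, c, d, e1, e2, e3, e4, hσ.invol]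

theorem switch_apply_left (σ : V → V) (u v : V) : switch σ u v u = v := by simp [switch]

/-- No two edges `u — σ u`, `v — σ v` are joined by two disjoint edges of `T`, that is, `T` has no
pair of edges whose union with two edges of `σ` is an alternating 4-cycle. -/
def NoSwitch (T : SimpleGraph V) (σ : V → V) : Prop :=
  ∀ u v, T.Adj u v → v ≠ σ u → ¬ T.Adj (σ u) (σ v)

theorem IsUniqueMate.noSwitch (h : IsUniqueMate H σ) : NoSwitch H σ := by
  intro u v huv hv hσuv
  have := congrFun (h.2 _ (h.1.switch huv hv hσuv)) u
  rw [switch_apply_left] at this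
  exact hv this

/-- Among the perfect matchings of `G`, one with the most edges in a rigid `T` admits no switch
inside `T`: a switch would produce either one with more edges in `T`, or a second perfect
matching that differs from it only within `T`. -/
theorem IsRigid.exists_noSwitch [Finite V] (hTG : T ≤ G) (hT : IsRigid G T)
    (hG : ∃ σ, IsMate G σ) : ∃ σ, IsMate G σ ∧ NoSwitch T σ := by
  obtain ⟨σ, hσ, hmax⟩ := Set.exists_max_image {σ : V → V | IsMate G σ}
    (fun σ => {u | T.Adj u (σ u)}.ncard) (Set.toFinite _) hG
  refine ⟨σ, hσ, fun u v huv hv hσuv => ?_⟩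
  have hτ := hσ.switch (hTG huv) hv (hTG hσuv)
  have hsw : ∀ w, switch σ u v w ≠ σ w → T.Adj w (switch σ u v w) := by
    intro w
    unfold switch
    split_ifs with a b c d
    · rw [a]; exact fun _ => huv
    · rw [b]; exact fun _ => huv.symm
    · rw [c]; exact fun _ => hσuv
    · rw [d]; exact fun _ => hσuv.symm
    · exact fun h => absurd rfl h
  have hsub : {w | T.Adj w (σ w)} ⊆ {w | T.Adj w (switch σ u v w)} := by
    intro w hw
    by_cases h : switch σ u v w = σ w
    · simpa [h] using hw
    · exact hsw w h
  have heq := Set.eq_of_subset_of_ncard_le hsub (hmax _ hτ) (Set.toFinite _)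
  have key : σ = switch σ u v := by
    refine hT _ _ hσ hτ fun w hw => ?_
    have h1 := hsw w (Ne.symm hw)
    exact ⟨(Set.ext_iff.1 heq w).2 h1, h1⟩
  have := congrFun key u
  rw [switch_apply_left] at this
  exact hv this.symm

/-! ### Counting edges -/

open scoped Classical in
theorem two_mul_ncard_edgeSet [Fintype V] (H : SimpleGraph V) :
    2 * H.edgeSet.ncard = ∑ v, H.degree v := by
  rw [H.sum_degrees_eq_twice_card_edges, Set.ncard_eq_toFinset_card', SimpleGraph.edgeFinset]

open scoped Classical in
/-- If `X` consists of vertices `w` such that neither `u — w` nor `σ u — σ w` is an edge, then `X`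
is missed both by the neighbours of `u` and by the partners of the neighbours of `σ u`. -/
theorem NoSwitch.degree_add_degree_le [Fintype V] (hσ : IsMate G σ) (hT : NoSwitch T σ) (u : V)
    (X : Finset V) (hX : ∀ w ∈ X, w ≠ u ∧ w ≠ σ u ∧ ¬ T.Adj u w ∧ ¬ T.Adj (σ u) (σ w)) :
    T.degree u + T.degree (σ u) + X.card ≤ Fintype.card V := by
  set N₁ := (T.neighborFinset u).erase (σ u) with hN₁
  set N₂ := ((T.neighborFinset (σ u)).erase u).image σ with hN₂
  have m1 : ∀ w, w ∈ N₁ ↔ w ≠ σ u ∧ T.Adj u w := by simp [hN₁]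
  have m2 : ∀ w, w ∈ N₂ ↔ w ≠ σ u ∧ T.Adj (σ u) (σ w) := by
    intro w
    simp only [hN₂, Finset.mem_image, Finset.mem_erase, SimpleGraph.mem_neighborFinset]
    constructor
    · rintro ⟨x, ⟨h1, h2⟩, rfl⟩
      rw [hσ.invol]
      exact ⟨fun h => h1 (hσ.injective h), h2⟩
    · rintro ⟨h1, h2⟩
      exact ⟨σ w, ⟨fun h => h1 (hσ.eq_iff.1 h), h2⟩, hσ.invol w⟩
  have c1 : T.degree u ≤ N₁.card + 1 := by
    rw [← SimpleGraph.card_neighborFinset_eq_degree, hN₁]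
    have := Finset.pred_card_le_card_erase (s := T.neighborFinset u) (a := σ u)
    omega
  have c2 : T.degree (σ u) ≤ N₂.card + 1 := by
    rw [← SimpleGraph.card_neighborFinset_eq_degree, hN₂,
      Finset.card_image_of_injective _ hσ.injective]
    have := Finset.pred_card_le_card_erase (s := T.neighborFinset (σ u)) (a := u)
    omega
  have d1 : Disjoint N₁ N₂ := by
    rw [Finset.disjoint_left]
    intro w h1 h2
    rw [m1] at h1
    rw [m2] at h2
    exact hT u w h1.2 h1.1 h2.2
  have d2 : Disjoint (N₁ ∪ N₂) X := by
    rw [Finset.disjoint_left]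
    intro w h1 h2
    have := hX w h2
    rw [Finset.mem_union, m1, m2] at h1
    tauto
  have d3 : Disjoint (N₁ ∪ N₂ ∪ X) {u, σ u} := by
    rw [Finset.disjoint_right]
    intro w h1 h2
    rw [Finset.mem_union, Finset.mem_union, m1, m2] at h2
    rw [Finset.mem_insert, Finset.mem_singleton] at h1
    rcases h1 with rfl | rfl
    · rcases h2 with (h2 | h2) | h2
      · exact T.irrefl h2.2
      · exact T.irrefl h2.2
      · exact (hX _ h2).1 rfl
    · rcases h2 with (h2 | h2) | h2
      · exact h2.1 rfl
      · exact h2.1 rfl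
      · exact (hX _ h2).2.1 rfl
  have := Finset.card_le_univ (N₁ ∪ N₂ ∪ X ∪ {u, σ u})
  rw [Finset.card_union_of_disjoint d3, Finset.card_union_of_disjoint d2,
    Finset.card_union_of_disjoint d1, Finset.card_pair (hσ.ne u).symm] at this
  omega

open scoped Classical in
theorem four_mul_ncard_edgeSet [Fintype V] (hσ : IsMate G σ) (T : SimpleGraph V) :
    4 * T.edgeSet.ncard = ∑ v, (T.degree v + T.degree (σ v)) := by
  have : ∑ v, T.degree (σ v) = ∑ v, T.degree v :=
    Equiv.sum_comp (Function.Involutive.toPerm σ hσ.invol) (fun v => T.degree v)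
  rw [Finset.sum_add_distrib, this, ← two_mul_ncard_edgeSet]
  ring

theorem NoSwitch.ncard_edgeSet_le [Fintype V] {n : ℕ} (hcard : Fintype.card V = 2 * n)
    (hσ : IsMate G σ) (hT : NoSwitch T σ) : T.edgeSet.ncard ≤ n ^ 2 := by
  classical
  have h1 := four_mul_ncard_edgeSet hσ T
  have h2 : ∑ v, (T.degree v + T.degree (σ v)) ≤ ∑ _v : V, 2 * n := by
    refine Finset.sum_le_sum fun v _ => ?_
    have := hT.degree_add_degree_le hσ v ∅ (by simp)
    simpa [hcard] using this
  rw [Finset.sum_const, Finset.card_univ, hcard, smul_eq_mul] at h2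
  nlinarith

theorem ncard_edgeSet_toSubgraph [Fintype V] {n : ℕ} (hcard : Fintype.card V = 2 * n)
    (hσ : IsMate G σ) : hσ.toSubgraph.spanningCoe.edgeSet.ncard = n := by
  classical
  have h := two_mul_ncard_edgeSet hσ.toSubgraph.spanningCoe
  have h1 : ∀ v, hσ.toSubgraph.spanningCoe.degree v = 1 := by
    intro v
    rw [← SimpleGraph.card_neighborFinset_eq_degree, Finset.card_eq_one]
    refine ⟨σ v, ?_⟩
    ext w
    rw [SimpleGraph.mem_neighborFinset, Finset.mem_singleton]
    exact eq_comm
  simp only [h1, Finset.sum_const, Finset.card_univ, hcard, smul_eq_mul] at h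
  omega

theorem ncard_edgeSet_le_mul [Fintype V] {n : ℕ} (hcard : Fintype.card V = 2 * n)
    (G : SimpleGraph V) : G.edgeSet.ncard ≤ n * (2 * n - 1) := by
  classical
  have h := two_mul_ncard_edgeSet G
  have h2 : ∑ v, G.degree v ≤ ∑ _v : V, (2 * n - 1) :=
    Finset.sum_le_sum fun v _ => by
      have := G.degree_lt_card_verts v
      omega
  rw [Finset.sum_const, Finset.card_univ, hcard, smul_eq_mul, mul_assoc, ← h] at h2
  omega

/-! ### Bounds on anti-forcing numbers -/

/-- A set containing exactly one end of each edge of a perfect matching. -/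
theorem IsMate.exists_transversal [Finite V] (hσ : IsMate G σ) :
    ∃ B : Set V, ∀ v, v ∈ B ↔ σ v ∉ B := by
  obtain ⟨k, ⟨e⟩⟩ := Finite.exists_equiv_fin V
  refine ⟨{v | e v < e (σ v)}, fun v => ?_⟩
  have : e v ≠ e (σ v) := fun h => hσ.ne v (e.injective h).symm
  simp only [Set.mem_ofPred_eq, hσ.invol, not_lt]
  exact ⟨le_of_lt, fun h => lt_of_le_of_ne h this⟩

/-- The edges of `σ` in `G`, together with those edges between two of them whose end of lower
rank `r` lies in `B`. -/
def layered (G : SimpleGraph V) (σ : V → V) (r : V → ℕ) (B : Set V) : SimpleGraph V where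
  Adj u v := G.Adj u v ∧ (σ u = v ∨ σ v = u ∨ (r u < r v ∧ u ∈ B) ∨ (r v < r u ∧ v ∈ B))
  symm := ⟨fun _ _ h => ⟨h.1.symm, by tauto⟩⟩
  loopless := ⟨fun _ h => G.irrefl h.1⟩

/-- In the order of `r`, each vertex outside `B` has all its neighbours but its partner among the
earlier vertices, which forces the perfect matching. -/
theorem isUniqueMate_layered (hσ : IsMate G σ) (r : V → ℕ) (hr : ∀ v, r (σ v) = r v) (B : Set V)
    (hB : ∀ v, v ∈ B ↔ σ v ∉ B) : IsUniqueMate (layered G σ r B) σ := by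
  refine ⟨⟨fun v => ⟨hσ.adj v, Or.inl rfl⟩, hσ.invol⟩, fun τ hτ => ?_⟩
  have key : ∀ k v, r v = k → τ v = σ v := by
    intro k
    induction k using Nat.strong_induction_on with
    | _ k ih =>
    have aux : ∀ v, r v = k → v ∉ B → τ v = σ v := by
      intro v hv hvB
      rcases (hτ.adj v).2 with h | h | h | h
      · exact h.symm
      · rw [← h, hσ.invol, h]
      · exact absurd h.2 hvB
      · have h1 := ih (r (τ v)) (hv ▸ h.1) (τ v) rfl
        rw [hτ.invol] at h1
        exact hσ.eq_iff.1 h1.symm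
    intro v hv
    by_cases hvB : v ∈ B
    · have := aux (σ v) ((hr v).trans hv) ((hB v).1 hvB)
      rw [hσ.invol] at this
      exact hτ.eq_iff.1 this |>.symm
    · exact aux v hv hvB
  exact funext fun v => key _ v rfl

/-- Of the two layered graphs obtained from complementary transversals, one has at least half of
the edges of `G` outside the perfect matching. -/
theorem two_mul_antiForcingNumber_add_le [Fintype V] {n : ℕ} (hcard : Fintype.card V = 2 * n)
    {M : G.Subgraph} (hM : M.IsPerfectMatching) :
    2 * antiForcingNumber G M + n ≤ G.edgeSet.ncard := by
  obtain ⟨σ, hσ, hMσ⟩ := exists_isMate hM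
  obtain ⟨B, hB⟩ := hσ.exists_transversal
  obtain ⟨k, ⟨e⟩⟩ := Finite.exists_equiv_fin V
  set r : V → ℕ := fun v => min (e v) (e (σ v)) with hr
  have hrσ : ∀ v, r (σ v) = r v := fun v => by simp only [hr, hσ.invol, min_comm]
  have hrinj : ∀ u v, r u = r v → u = v ∨ σ u = v := by
    intro u v h
    have aux : ∀ x y : V, (e x : ℕ) = e y → x = y := fun x y hxy => e.injective (Fin.ext hxy)
    simp only [hr] at h
    rcases min_choice (e u : ℕ) (e (σ u)) with h1 | h1 <;>
      rcases min_choice (e v : ℕ) (e (σ v)) with h2 | h2 <;> rw [h1, h2] at h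
    · exact Or.inl (aux _ _ h)
    · exact Or.inr (by rw [aux _ _ h, hσ.invol])
    · exact Or.inr (aux _ _ h)
    · exact Or.inl (hσ.injective (aux _ _ h))
  have hBc : ∀ v, v ∈ Bᶜ ↔ σ v ∉ Bᶜ := fun v => by
    rw [Set.mem_compl_iff, Set.mem_compl_iff, hB v]
  have hle : ∀ C, layered G σ r C ≤ G := fun C u v h => h.1
  have h1 := antiForcingNumber_add_le hσ hMσ (hle B) (isUniqueMate_layered hσ r hrσ B hB)
  have h2 := antiForcingNumber_add_le hσ hMσ (hle Bᶜ) (isUniqueMate_layered hσ r hrσ Bᶜ hBc)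
  have h3 : G.edgeSet ⊆ (layered G σ r B).edgeSet ∪ (layered G σ r Bᶜ).edgeSet := by
    intro f hf
    induction f with
    | _ u v =>
    rw [SimpleGraph.mem_edgeSet] at hf
    simp only [Set.mem_union, SimpleGraph.mem_edgeSet, layered, Set.mem_compl_iff]
    rcases lt_trichotomy (r u) (r v) with h | h | h
    · tauto
    · rcases hrinj u v h with rfl | h
      · exact absurd hf G.irrefl
      · tauto
    · tauto
  have h4 : hσ.toSubgraph.spanningCoe.edgeSet ⊆
      (layered G σ r B).edgeSet ∩ (layered G σ r Bᶜ).edgeSet := by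
    intro f hf
    induction f with
    | _ u v =>
    have hf' : σ u = v := hf
    have hG : G.Adj u v := hf' ▸ hσ.adj u
    exact ⟨⟨hG, Or.inl hf'⟩, ⟨hG, Or.inl hf'⟩⟩
  have h5 := Set.ncard_union_add_ncard_inter (layered G σ r B).edgeSet (layered G σ r Bᶜ).edgeSet
  have h6 := Set.ncard_le_ncard h3
  have h7 := Set.ncard_le_ncard h4
  rw [ncard_edgeSet_toSubgraph hcard hσ] at h7
  omega

/-- Perfect matchings are determined by their traces on a global forcing set `S`, so there are at
most `2 ^ |S|` of them; removing one suitable edge of each of the others makes `M` unique. -/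
theorem antiForcingNumber_lt_two_pow [Finite V] {M : G.Subgraph} (hM : M.IsPerfectMatching)
    {S : Set (Sym2 V)} (hS : IsGlobalForcingSet G S) : antiForcingNumber G M < 2 ^ S.ncard := by
  obtain ⟨σ, hσ, hMσ⟩ := exists_isMate hM
  set P : Set (V → V) := {τ | IsMate G τ} with hP
  have hPcard : P.ncard ≤ 2 ^ S.ncard := by
    rw [← Set.ncard_powerset S (Set.toFinite S)]
    refine Set.ncard_le_ncard_of_injOn (fun τ => {e ∈ S | ∃ v, e = s(v, τ v)})
      (fun τ _ => Set.sep_subset _ _) ?_ (Set.toFinite _)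
    intro τ hτ τ' hτ' h
    have key : ∀ τ₁ τ₂ : V → V, IsMate G τ₂ →
        {e ∈ S | ∃ v, e = s(v, τ₁ v)} = {e ∈ S | ∃ v, e = s(v, τ₂ v)} →
        ∀ u, τ₁ u ≠ τ₂ u → (G.deleteEdges S).Adj u (τ₁ u) ∨ ¬ G.Adj u (τ₁ u) := by
      intro τ₁ τ₂ h₂ h u hu
      by_contra hc
      rw [SimpleGraph.deleteEdges_adj] at hc
      push Not at hc
      obtain ⟨-, v, hv⟩ := (Set.ext_iff.1 h s(u, τ₁ u)).1 ⟨hc.1 hc.2, u, rfl⟩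
      rcases Sym2.eq_iff.1 hv with ⟨h3, h4⟩ | ⟨h3, h4⟩
      · exact hu (h4.trans (by rw [h3]))
      · exact hu (by rw [h4, h3, h₂.invol])
    refine hS.isRigid _ _ hτ hτ' fun u hu => ⟨?_, ?_⟩
    · exact (key τ τ' hτ' h u hu).resolve_right (not_not.2 (hτ.adj u))
    · exact (key τ' τ hτ h.symm u hu.symm).resolve_right (not_not.2 (hτ'.adj u))
  have hdiff : ∀ τ : ↥{τ | IsMate G τ ∧ τ ≠ σ}, ∃ v, τ.1 v ≠ σ v :=
    fun τ => Function.ne_iff.1 τ.2.2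
  choose f hf using hdiff
  set D : Set (Sym2 V) := Set.range fun τ => s(f τ, τ.1 (f τ)) with hD
  have hDanti : IsAntiForcingSet G M D := by
    rw [isAntiForcingSet_iff hσ hMσ]
    refine ⟨?_, ⟨fun v => ?_, hσ.invol⟩, fun τ hτ => ?_⟩
    · rintro _ ⟨τ, rfl⟩
      exact τ.2.1.adj _
    · rw [SimpleGraph.deleteEdges_adj]
      refine ⟨hσ.adj v, ?_⟩
      rintro ⟨τ, h⟩
      rcases Sym2.eq_iff.1 h with ⟨h3, h4⟩ | ⟨h3, h4⟩
      · exact hf τ (by rw [h4, h3])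
      · exact hf τ (by rw [h4, h3, hσ.invol])
    · by_contra hne
      have hτG := hτ.mono (SimpleGraph.deleteEdges_le D)
      exact (SimpleGraph.deleteEdges_adj.1 (hτ.adj (f ⟨τ, hτG, hne⟩))).2 ⟨⟨τ, hτG, hne⟩, rfl⟩
  have h1 : antiForcingNumber G M ≤ D.ncard := Nat.sInf_le ⟨D, hDanti, rfl⟩
  have h2 : D.ncard ≤ (P \ {σ}).ncard := Finite.card_range_le _
  have h3 := Set.ncard_sdiff_singleton_lt_of_mem (show σ ∈ P from hσ) (Set.toFinite _)
  omega

/-! ### Connecting rigid subgraphs -/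

theorem even_card_of_involution [DecidableEq V] (W : Finset V) (f : V → V)
    (hW : ∀ w ∈ W, f w ∈ W) (hne : ∀ w ∈ W, f w ≠ w) (hinv : ∀ w ∈ W, f (f w) = w) :
    Even W.card := by
  have h : ∑ _w ∈ W, (1 : ZMod 2) = 0 :=
    Finset.sum_involution (fun w _ => f w) (fun _ _ => by decide) (fun w hw _ => hne w hw)
      hW hinv
  rw [Finset.sum_const, nsmul_one] at h
  exact (ZMod.natCast_eq_zero_iff_even).1 h

/-- Adding an edge between two components of `T` keeps `T` rigid. Otherwise let `σ` use the new
edge `u — v` and `τ` not, and let `W` be the set of vertices in the component of `u` in `T` where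
they differ: then `τ` pairs off `W`, and `σ` pairs off `W` without `u`. -/
theorem IsRigid.sup_edge [Finite V] (hT : IsRigid G T) {u v : V} (huv : ¬ T.Reachable u v) :
    IsRigid G (T ⊔ SimpleGraph.edge u v) := by
  classical
  have := Fintype.ofFinite V
  have hadj : ∀ {x y}, (T ⊔ SimpleGraph.edge u v).Adj x y →
      T.Adj x y ∨ (x = u ∧ y = v) ∨ (x = v ∧ y = u) := by
    intro x y h
    rw [SimpleGraph.sup_adj, SimpleGraph.edge_adj] at h
    tauto
  have key : ∀ σ τ, IsMate G σ → IsMate G τ →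
      (∀ w, σ w ≠ τ w → (T ⊔ SimpleGraph.edge u v).Adj w (σ w) ∧
        (T ⊔ SimpleGraph.edge u v).Adj w (τ w)) → σ u = v → τ u = v := by
    intro σ τ hσ hτ h hu
    by_contra hτu
    set W : Finset V := {w | T.Reachable u w ∧ σ w ≠ τ w} with hW
    have mW : ∀ w, w ∈ W ↔ T.Reachable u w ∧ σ w ≠ τ w := by simp [hW]
    have e1 : Even W.card := by
      refine even_card_of_involution W τ (fun w hw => ?_) (fun w _ => hτ.ne w)
        (fun w _ => hτ.invol w)
      rw [mW] at hw ⊢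
      refine ⟨?_, fun hc => hw.2 ?_⟩
      · rcases hadj (h w hw.2).2 with h1 | h1 | h1
        · exact hw.1.trans h1.reachable
        · exact absurd (h1.1 ▸ h1.2) hτu
        · exact absurd (h1.1 ▸ hw.1) huv
      · rw [hτ.invol] at hc
        exact (hσ.eq_iff.1 hc).symm
    have hne : ∀ w ∈ W.erase u, σ w ≠ u := by
      intro w hw hc
      rw [Finset.mem_erase, mW] at hw
      have : w = v := by rw [← hu, ← hc, hσ.invol]
      exact huv (this ▸ hw.2.1)
    have e2 : Even (W.erase u).card := by
      refine even_card_of_involution _ σ (fun w hw => ?_) (fun w _ => hσ.ne w)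
        (fun w _ => hσ.invol w)
      have hwu := hne w hw
      rw [Finset.mem_erase, mW] at hw ⊢
      refine ⟨hwu, ?_, fun hc => hw.2.2 ?_⟩
      · rcases hadj (h w hw.2.2).1 with h1 | h1 | h1
        · exact hw.2.1.trans h1.reachable
        · exact absurd h1.1 hw.1
        · exact absurd h1.2 hwu
      · rw [hσ.invol] at hc
        exact hτ.eq_iff.1 hc.symm
    have huW : u ∈ W := by
      rw [mW, hu]
      exact ⟨SimpleGraph.Reachable.refl u, Ne.symm hτu⟩
    rw [← Finset.card_erase_add_one huW] at e1
    exact (Nat.not_even_iff_odd.2 e2.add_one) e1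
  intro σ τ hσ hτ h
  have h' : ∀ w, τ w ≠ σ w → (T ⊔ SimpleGraph.edge u v).Adj w (τ w) ∧
      (T ⊔ SimpleGraph.edge u v).Adj w (σ w) := fun w hw => (h w hw.symm).symm
  have hiff : σ u = v ↔ τ u = v := ⟨key σ τ hσ hτ h, key τ σ hτ hσ h'⟩
  have hiff' : σ v = u ↔ τ v = u := by
    rw [hσ.eq_iff, hτ.eq_iff, eq_comm, hiff, eq_comm]
  refine hT σ τ hσ hτ fun w hw => ⟨?_, ?_⟩
  · rcases hadj (h w hw).1 with h1 | ⟨rfl, h1⟩ | ⟨rfl, h1⟩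
    · exact h1
    · exact absurd (h1.trans (hiff.1 h1).symm) hw
    · exact absurd (h1.trans (hiff'.1 h1).symm) hw
  · rcases hadj (h w hw).2 with h1 | ⟨rfl, h1⟩ | ⟨rfl, h1⟩
    · exact h1
    · exact absurd ((hiff.2 h1).trans h1.symm) hw
    · exact absurd ((hiff'.2 h1).trans h1.symm) hw

/-- In a connected graph every rigid subgraph is contained in a connected spanning one. -/
theorem IsRigid.exists_connected_ge [Finite V] (hconn : G.Connected) (hTG : T ≤ G)
    (hT : IsRigid G T) : ∃ T', T ≤ T' ∧ T' ≤ G ∧ IsRigid G T' ∧ T'.Connected := by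
  obtain ⟨T', hTT', ⟨hTG', hT'⟩, hmax⟩ :=
    (Set.toFinite {T | T ≤ G ∧ IsRigid G T}).exists_le_maximal (a := T) ⟨hTG, hT⟩
  refine ⟨T', hTT', hTG', hT', ?_⟩
  have := hconn.nonempty
  refine SimpleGraph.Connected.mk fun u v => ?_
  have hstep : ∀ x y, G.Adj x y → T'.Reachable x y := by
    intro x y hxy
    by_contra hc
    have hle : T' ⊔ SimpleGraph.edge x y ≤ G := by
      refine sup_le hTG' fun a b hab => ?_
      rw [SimpleGraph.edge_adj] at hab
      rcases hab.1 with ⟨rfl, rfl⟩ | ⟨rfl, rfl⟩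
      · exact hxy
      · exact hxy.symm
    refine hc (SimpleGraph.Adj.reachable (hmax ⟨hle, hT'.sup_edge hc⟩ le_sup_left ?_))
    rw [SimpleGraph.sup_adj, SimpleGraph.edge_adj]
    exact Or.inr ⟨Or.inl ⟨rfl, rfl⟩, hxy.ne⟩
  obtain ⟨p⟩ := hconn.preconnected u v
  induction p with
  | nil => exact SimpleGraph.Reachable.refl _
  | cons h _ ih => exact (hstep _ _ h).trans ih

/-! ### Branchings of triangles -/

/-- A family of triangles `x v — v — σ v` of `H`, one for each edge `v — σ v` of the perfect
matching without an end in `R`. The depth `δ` decreases from `v` to the apex `x v`, so the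
triangles form a branching whose roots are the edges of `σ` that meet `R`. -/
structure IsTriangleBranching (H : SimpleGraph V) (σ : V → V) (R : Set V) (δ : V → ℕ)
    (x : V → V) : Prop where
  depth_mate : ∀ v, δ (σ v) = δ v
  apex_mate : ∀ v, x (σ v) = x v
  depth_apex_lt : ∀ v, v ∉ R → σ v ∉ R → δ (x v) < δ v
  adj_apex : ∀ v, v ∉ R → σ v ∉ R → H.Adj (x v) v

open Relation in
/-- Take a minimum set `R` of roots from which every edge of the perfect matching is reached,
where one may step from a vertex `a`, or from its partner, to `b` if `a`, `b`, `σ b` form a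
triangle. By minimality no root is reached from another. -/
theorem exists_roots [Finite V] (hσ : IsMate H σ) :
    ∃ (R : Finset V) (δ : V → ℕ) (x : V → V), IsTriangleBranching H σ R δ x ∧
      ∀ r ∈ R, ∀ r' ∈ R, r ≠ r' → r' ≠ σ r ∧
        ∀ a, a = r ∨ a = σ r → ¬ (H.Adj a r' ∧ H.Adj a (σ r')) := by
  classical
  have := Fintype.ofFinite V
  let Q : V → V → Prop := fun a b => b = σ a ∨ (H.Adj a b ∧ H.Adj a (σ b))
  obtain ⟨R, hR, hmin⟩ := Set.exists_min_image
    {R : Finset V | ∀ v, ∃ r ∈ R, ReflTransGen Q r v} Finset.card (Set.toFinite _)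
    ⟨Finset.univ, fun v => ⟨v, Finset.mem_univ v, .refl⟩⟩
  have hindep : ∀ r ∈ R, ∀ r' ∈ R, r ≠ r' → ¬ ReflTransGen Q r r' := by
    intro r hr r' hr' hne hc
    have : R.card ≤ (R.erase r').card := hmin _ fun v => by
      obtain ⟨s, hs, hsv⟩ := hR v
      by_cases h : s = r'
      · exact ⟨r, Finset.mem_erase.2 ⟨hne, hr⟩, hc.trans (h ▸ hsv)⟩
      · exact ⟨s, Finset.mem_erase.2 ⟨h, hs⟩, hsv⟩
    exact absurd (Finset.card_erase_lt_of_mem hr') (not_lt.2 this)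
  -- `L k` is the set of vertices of depth at most `k`.
  let L : ℕ → Set V := fun k => Nat.rec {v | v ∈ R ∨ σ v ∈ R}
    (fun _ A => {v | v ∈ A ∨ ∃ a ∈ A, H.Adj a v ∧ H.Adj a (σ v)}) k
  have hL0 : ∀ v, v ∈ L 0 ↔ v ∈ R ∨ σ v ∈ R := fun v => Iff.rfl
  have hLs : ∀ k v, v ∈ L (k + 1) ↔ v ∈ L k ∨ ∃ a ∈ L k, H.Adj a v ∧ H.Adj a (σ v) :=
    fun k v => Iff.rfl
  have hLσ : ∀ k v, v ∈ L k → σ v ∈ L k := by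
    intro k
    induction k with
    | zero =>
      intro v hv
      rw [hL0] at hv ⊢
      rw [hσ.invol]
      exact hv.symm
    | succ k ih =>
      intro v hv
      rw [hLs] at hv ⊢
      rw [hσ.invol]
      rcases hv with hv | ⟨a, ha, h1, h2⟩
      · exact Or.inl (ih v hv)
      · exact Or.inr ⟨a, ha, h2, h1⟩
  have hLex : ∀ v, ∃ k, v ∈ L k := by
    intro v
    obtain ⟨r, hr, hrv⟩ := hR v
    induction hrv with
    | refl => exact ⟨0, Or.inl hr⟩
    | tail _ hbc ih =>
      obtain ⟨k, hk⟩ := ih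
      rcases hbc with rfl | h
      · exact ⟨k, hLσ k _ hk⟩
      · exact ⟨k + 1, Or.inr ⟨_, hk, h⟩⟩
  obtain ⟨δ, hδ, hδle⟩ : ∃ δ : V → ℕ, (∀ v, v ∈ L (δ v)) ∧ ∀ v k, v ∈ L k → δ v ≤ k := by
    refine ⟨fun v => sInf {k | v ∈ L k}, fun v => ?_, fun v k hk => Nat.sInf_le hk⟩
    exact Nat.sInf_mem (s := {k | v ∈ L k}) (hLex v)
  have hδσ : ∀ v, δ (σ v) = δ v := fun v =>
    le_antisymm (hδle _ _ (hLσ _ _ (hδ v)))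
      (hδle _ _ (by have := hLσ _ _ (hδ (σ v)); rwa [hσ.invol] at this))
  have hparent : ∀ v, ∃ a, v ∉ R → σ v ∉ R → δ a < δ v ∧ H.Adj a v ∧ H.Adj a (σ v) := by
    intro v
    by_cases hv : v ∈ R ∨ σ v ∈ R
    · exact ⟨v, by tauto⟩
    · obtain ⟨k, hk⟩ : ∃ k, δ v = k + 1 := by
        refine Nat.exists_eq_succ_of_ne_zero fun h0 => hv ?_
        have := hδ v
        rwa [h0] at this
      have h1 := hδ v
      rw [hk, hLs] at h1
      rcases h1 with h1 | ⟨a, ha, h2⟩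
      · have := hδle _ _ h1
        omega
      · have := hδle _ _ ha
        exact ⟨a, fun _ _ => ⟨by omega, h2⟩⟩
  choose y hy using hparent
  -- The apex has to be chosen simultaneously for the two ends of an edge of `σ`.
  obtain ⟨B, hB⟩ := hσ.exists_transversal
  refine ⟨R, δ, fun v => if v ∈ B then y v else y (σ v), ⟨hδσ, fun v => ?_, fun v h1 h2 => ?_,
    fun v h1 h2 => ?_⟩, fun r hr r' hr' hne => ⟨?_, ?_⟩⟩
  · have := hB v
    by_cases h : v ∈ B
    · simp [h, this.1 h, hσ.invol]
    · have h' : σ v ∈ B := by tauto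
      simp [h, h']
  · split_ifs with h
    · exact (hy v h1 h2).1
    · have := (hy (σ v) h2 (by rwa [hσ.invol])).1
      rwa [hδσ v] at this
  · split_ifs with h
    · exact (hy v h1 h2).2.1
    · have := (hy (σ v) h2 (by rwa [hσ.invol])).2.2
      rwa [hσ.invol] at this
  · exact fun h => hindep r hr r' hr' hne (.single (Or.inl h))
  · rintro a (rfl | rfl) h
    · exact hindep a hr r' hr' hne (.single (Or.inr h))
    · exact hindep r hr r' hr' hne (.head (Or.inl rfl) (.single (Or.inr h)))

/-- The graph formed by the edges of `σ` and by the triangles of a branching. -/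
def branchingGraph (H : SimpleGraph V) (σ : V → V) (R : Set V) (x : V → V) : SimpleGraph V where
  Adj a b := H.Adj a b ∧ (σ a = b ∨ σ b = a ∨ (b ∉ R ∧ σ b ∉ R ∧ a = x b) ∨
    (a ∉ R ∧ σ a ∉ R ∧ b = x a))
  symm := ⟨fun _ _ h => ⟨h.1.symm, by tauto⟩⟩
  loopless := ⟨fun _ h => H.irrefl h.1⟩

/-- If two perfect matchings differ only within the branching, consider a vertex `v` of maximum
depth where they differ. Both edges at `v` and both edges at `σ v` belong to the triangle on
`v`, `σ v` and the apex `x v`. So one perfect matching contains `v — σ v`, and the other contains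
both `v — x v` and `σ v — x v`, which is absurd. -/
theorem IsTriangleBranching.isRigid [Finite V] {R : Set V} {δ : V → ℕ} {x : V → V}
    (hσ : IsMate H σ) (hx : IsTriangleBranching H σ R δ x) :
    IsRigid G (branchingGraph H σ R x) := by
  intro ρ τ hρ hτ h
  by_contra hne
  obtain ⟨v₀, hv₀⟩ := Function.ne_iff.1 hne
  obtain ⟨v, hv, hmax⟩ := Set.exists_max_image {v | ρ v ≠ τ v} δ (Set.toFinite _) ⟨v₀, hv₀⟩
  have hdiffρ : ∀ w, ρ w ≠ τ w → ρ (ρ w) ≠ τ (ρ w) := fun w hw hc => hw (by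
    rw [hρ.invol] at hc
    exact (hτ.eq_iff.1 hc.symm))
  have hdiffτ : ∀ w, ρ w ≠ τ w → ρ (τ w) ≠ τ (τ w) := fun w hw hc => hw (by
    rw [hτ.invol] at hc
    exact (hρ.eq_iff.1 hc).symm)
  -- At a vertex of maximum depth, the edges where the matchings differ lead to the partner or to
  -- the apex.
  have hnbr : ∀ w, δ w = δ v → ∀ b, (branchingGraph H σ R x).Adj w b → ρ b ≠ τ b →
      b = σ w ∨ (w ∉ R ∧ σ w ∉ R ∧ b = x w) := by
    rintro w hw b ⟨-, h1 | h1 | h1 | h1⟩ hb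
    · exact Or.inl h1.symm
    · exact Or.inl (hσ.eq_iff.1 h1)
    · have h2 := hx.depth_apex_lt b h1.1 h1.2.1
      have h3 := hmax b hb
      rw [← h1.2.2, hw] at h2
      omega
    · exact Or.inr h1
  have hpair : ∀ w, δ w = δ v → ρ w ≠ τ w → w ∉ R ∧ σ w ∉ R ∧
      ((ρ w = σ w ∧ τ w = x w) ∨ (ρ w = x w ∧ τ w = σ w)) := by
    intro w hw hd
    have h1 := hnbr w hw _ (h w hd).1 (hdiffρ w hd)
    have h2 := hnbr w hw _ (h w hd).2 (hdiffτ w hd)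
    rcases h1 with h1 | h1 <;> rcases h2 with h2 | h2
    · exact absurd (h1.trans h2.symm) hd
    · exact ⟨h2.1, h2.2.1, Or.inl ⟨h1, h2.2.2⟩⟩
    · exact ⟨h1.1, h1.2.1, Or.inr ⟨h1.2.2, h2⟩⟩
    · exact absurd (h1.2.2.trans h2.2.2.symm) hd
  obtain ⟨-, -, h1⟩ := hpair v rfl hv
  have hv' : ρ (σ v) ≠ τ (σ v) := by
    rcases h1 with h1 | h1
    · rw [← h1.1]; exact hdiffρ v hv
    · rw [← h1.2]; exact hdiffτ v hv
  obtain ⟨-, -, h2⟩ := hpair (σ v) (hx.depth_mate v) hv'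
  rw [hσ.invol, hx.apex_mate] at h2
  have hσv := hσ.ne v
  rcases h1 with h1 | h1 <;> rcases h2 with h2 | h2
  · exact hσv (hτ.injective (h2.2.trans h1.2.symm))
  · exact hv (h1.1.trans (hτ.eq_iff.1 h2.2))
  · exact hv ((hρ.eq_iff.1 h2.1).symm.trans h1.2.symm)
  · exact hσv (hρ.injective (h2.1.trans h1.1.symm))

open scoped Classical in
/-- Two roots span edges of the perfect matching that are joined by at most one edge of `H`, one
fewer than the two that are possible; summing over all pairs of roots gives the correction term. -/
theorem NoSwitch.two_mul_ncard_edgeSet_add_le [Fintype V] {n : ℕ}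
    (hcard : Fintype.card V = 2 * n) (hσ : IsMate H σ) (hH : NoSwitch H σ) (R : Finset V)
    (hR : ∀ r ∈ R, ∀ r' ∈ R, r ≠ r' → r' ≠ σ r ∧
      ∀ a, a = r ∨ a = σ r → ¬ (H.Adj a r' ∧ H.Adj a (σ r'))) :
    2 * H.edgeSet.ncard + R.card * (R.card - 1) ≤ 2 * n ^ 2 := by
  have hdeg : ∀ r ∈ R, H.degree r + H.degree (σ r) + (R.card - 1) ≤ 2 * n := by
    intro r hr
    have hw : ∀ r' : V, ∃ w, r' ∈ R.erase r →
        (w = r' ∨ w = σ r') ∧ ¬ H.Adj r w ∧ ¬ H.Adj (σ r) (σ w) := by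
      intro r'
      by_cases hr' : r' ∈ R.erase r
      · rw [Finset.mem_erase] at hr'
        have h1 := (hR r hr r' hr'.2 hr'.1.symm).2
        have h2 := (hR r' hr'.2 r hr hr'.1).2
        have a1 := h1 r (Or.inl rfl)
        have a2 := h1 (σ r) (Or.inr rfl)
        have a3 := h2 r' (Or.inl rfl)
        have a4 := h2 (σ r') (Or.inr rfl)
        rw [H.adj_comm r' r, H.adj_comm r' (σ r)] at a3
        rw [H.adj_comm (σ r') r, H.adj_comm (σ r') (σ r)] at a4
        by_cases h : ¬ H.Adj r r' ∧ ¬ H.Adj (σ r) (σ r')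
        · exact ⟨r', fun _ => ⟨Or.inl rfl, h⟩⟩
        · refine ⟨σ r', fun _ => ⟨Or.inr rfl, ?_⟩⟩
          rw [hσ.invol]
          tauto
      · exact ⟨r', fun h => absurd h hr'⟩
    choose w hw using hw
    have hinj : Set.InjOn w (R.erase r : Finset V) := by
      intro x hx y hy hxy
      have hx' := Finset.mem_of_mem_erase (Finset.mem_coe.1 hx)
      have hy' := Finset.mem_of_mem_erase (Finset.mem_coe.1 hy)
      by_contra hne
      have h1 := (hR x hx' y hy' hne).1
      have h2 := (hR y hy' x hx' (Ne.symm hne)).1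
      rcases (hw x hx).1 with e1 | e1 <;> rcases (hw y hy).1 with e2 | e2 <;>
        rw [e1, e2] at hxy
      · exact hne hxy
      · exact h2 hxy
      · exact h1 hxy.symm
      · exact hne (hσ.injective hxy)
    have := hH.degree_add_degree_le hσ r ((R.erase r).image w) (by
      intro y hy
      obtain ⟨x, hx, rfl⟩ := Finset.mem_image.1 hy
      obtain ⟨h1, h2⟩ := hw x hx
      rw [Finset.mem_erase] at hx
      have h3 := (hR r hr x hx.2 hx.1.symm).1
      refine ⟨?_, ?_, h2⟩
      · rcases h1 with h1 | h1 <;> rw [h1]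
        · exact hx.1
        · exact fun h => h3 (hσ.eq_iff.1 h)
      · rcases h1 with h1 | h1 <;> rw [h1]
        · exact h3
        · exact fun h => hx.1 (hσ.injective h))
    rwa [Finset.card_image_of_injOn hinj, Finset.card_erase_of_mem hr, hcard] at this
  set S : Finset V := R ∪ R.image σ with hS
  have hScard : S.card = 2 * R.card := by
    rw [hS, Finset.card_union_of_disjoint, Finset.card_image_of_injective _ hσ.injective]
    · ring
    · rw [Finset.disjoint_left]
      intro a ha ha'
      obtain ⟨b, hb, rfl⟩ := Finset.mem_image.1 ha'
      exact (hR b hb _ ha (hσ.ne b).symm).1 rfl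
  have hsum : ∑ v, (H.degree v + H.degree (σ v) + if v ∈ S then R.card - 1 else 0) ≤
      ∑ _v : V, 2 * n := by
    refine Finset.sum_le_sum fun v _ => ?_
    split_ifs with hv
    · rcases Finset.mem_union.1 hv with hv | hv
      · exact hdeg v hv
      · obtain ⟨b, hb, rfl⟩ := Finset.mem_image.1 hv
        rw [hσ.invol, add_comm (H.degree (σ b))]
        exact hdeg b hb
    · have := hH.degree_add_degree_le hσ v ∅ (by simp)
      simpa [hcard] using this
  rw [Finset.sum_add_distrib, ← four_mul_ncard_edgeSet hσ H, Finset.sum_ite_mem, Finset.univ_inter,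
    Finset.sum_const, Finset.sum_const, Finset.card_univ, hcard, hScard, smul_eq_mul,
    smul_eq_mul] at hsum
  nlinarith

/-- Deleting the edge `x v — v` from one triangle for each non-root edge `v — σ v` leaves a
connected graph, which still has at least `2 n - 1` edges. -/
theorem IsTriangleBranching.three_mul_le [Fintype V] {n : ℕ} (hcard : Fintype.card V = 2 * n)
    {R : Finset V} {δ : V → ℕ} {x : V → V} (hσ : IsMate H σ)
    (hx : IsTriangleBranching H σ R δ x) (hT : branchingGraph H σ R x ≤ T) (hconn : T.Connected) :
    3 * n ≤ T.edgeSet.ncard + 1 + R.card := by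
  classical
  obtain ⟨B, hB⟩ := hσ.exists_transversal
  set D : Finset V := {v | v ∈ B ∧ v ∉ R ∧ σ v ∉ R} with hD
  have mD : ∀ v, v ∈ D ↔ v ∈ B ∧ v ∉ R ∧ σ v ∉ R := by simp [hD]
  have hDcard : n ≤ D.card + R.card := by
    have hcov : (Finset.univ : Finset V) ⊆ (D ∪ R) ∪ (D ∪ R).image σ := by
      intro v _
      have h1 := hB v
      have h2 := mD v
      have h3 := mD (σ v)
      rw [hσ.invol] at h3
      rw [Finset.mem_union, Finset.mem_union, Finset.mem_image]
      by_cases h4 : v ∈ D ∪ R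
      · exact Or.inl (Finset.mem_union.1 h4)
      · refine Or.inr ⟨σ v, ?_, hσ.invol v⟩
        rw [Finset.mem_union] at h4 ⊢
        tauto
    have h1 := (Finset.card_le_card hcov).trans (Finset.card_union_le _ _)
    have h2 := Finset.card_union_le D R
    rw [Finset.card_image_of_injective _ hσ.injective, Finset.card_univ, hcard] at h1
    omega
  have hlt : ∀ v ∈ D, δ (x v) < δ v := fun v hv =>
    hx.depth_apex_lt v ((mD v).1 hv).2.1 ((mD v).1 hv).2.2
  have hadj : ∀ v ∈ D, (branchingGraph H σ R x).Adj (x v) v := fun v hv =>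
    ⟨hx.adj_apex v ((mD v).1 hv).2.1 ((mD v).1 hv).2.2,
      Or.inr (Or.inr (Or.inl ⟨((mD v).1 hv).2.1, ((mD v).1 hv).2.2, rfl⟩))⟩
  set E : Set (Sym2 V) := (fun v => s(x v, v)) '' (D : Set V) with hE
  have hEcard : E.ncard = D.card := by
    rw [hE, Set.InjOn.ncard_image, Set.ncard_coe_finset]
    intro v hv w hw h
    rcases Sym2.eq_iff.1 h with h1 | h1
    · exact h1.2
    · have h2 := hlt v hv
      have h3 := hlt w hw
      rw [h1.1] at h2
      rw [← h1.2] at h3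
      omega
  have hET : E ⊆ T.edgeSet := by
    rintro _ ⟨v, hv, rfl⟩
    exact hT (hadj v hv)
  have hcount := ncard_edgeSet_deleteEdges hET
  have hreach : ∀ v ∈ D, (T.deleteEdges E).Reachable (x v) v := by
    intro v hv
    obtain ⟨h1, h2, h3⟩ := (mD v).1 hv
    have h4 : (T.deleteEdges E).Adj (x v) (σ v) := by
      rw [SimpleGraph.deleteEdges_adj]
      refine ⟨hT ⟨?_, Or.inr (Or.inr (Or.inl ⟨h3, by rwa [hσ.invol], (hx.apex_mate v).symm⟩))⟩, ?_⟩
      · have := hx.adj_apex (σ v) h3 (by rwa [hσ.invol])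
        rwa [hx.apex_mate] at this
      · rintro ⟨w, hw, h⟩
        rcases Sym2.eq_iff.1 h with h5 | h5
        · have := ((mD w).1 hw).1
          rw [h5.2] at this
          exact (hB v).1 h1 this
        · have h6 := hlt w hw
          have h7 := hlt v hv
          rw [h5.1, hx.depth_mate, h5.2] at h6
          omega
    have h5 : (T.deleteEdges E).Adj (σ v) v := by
      rw [SimpleGraph.deleteEdges_adj]
      refine ⟨hT ⟨(hσ.adj v).symm, Or.inl (hσ.invol v)⟩, ?_⟩
      rintro ⟨w, hw, h⟩
      have h6 := hlt w hw
      have h7 := hx.depth_mate v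
      rcases Sym2.eq_iff.1 h with h5 | h5 <;> rw [h5.1, h5.2] at h6 <;> omega
    exact h4.reachable.trans h5.reachable
  have hconn' : (T.deleteEdges E).Connected := by
    have := hconn.nonempty
    refine SimpleGraph.Connected.mk fun a b => ?_
    obtain ⟨p⟩ := hconn.preconnected a b
    induction p with
    | nil => exact SimpleGraph.Reachable.refl _
    | @cons a b c h _ ih =>
      refine SimpleGraph.Reachable.trans ?_ ih
      by_cases hab : s(a, b) ∈ E
      · obtain ⟨v, hv, h⟩ := hab
        rcases Sym2.eq_iff.1 h with ⟨rfl, rfl⟩ | ⟨rfl, rfl⟩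
        · exact hreach _ hv
        · exact (hreach _ hv).symm
      · exact (SimpleGraph.deleteEdges_adj.2 ⟨h, hab⟩).reachable
  have h := hconn'.card_vert_le_card_edgeSet_add_one
  rw [Nat.card_eq_fintype_card, hcard, Nat.card_coe_set_eq] at h
  omega

/-! ### Comparison of the two numbers -/

theorem ncard_edgeSet_le_sq_add_globalForcingNumber [Fintype V] {n : ℕ}
    (hcard : Fintype.card V = 2 * n) (hpm : ∃ M : G.Subgraph, M.IsPerfectMatching) :
    G.edgeSet.ncard ≤ n ^ 2 + globalForcingNumber G := by
  obtain ⟨M, hM⟩ := hpm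
  obtain ⟨σ, hσ, -⟩ := exists_isMate hM
  obtain ⟨S, hS, hSc⟩ := exists_isGlobalForcingSet G
  obtain ⟨τ, hτ, hsw⟩ := hS.isRigid.exists_noSwitch (SimpleGraph.deleteEdges_le S) ⟨σ, hσ⟩
  have h1 := hsw.ncard_edgeSet_le hcard hτ
  have h2 := ncard_edgeSet_deleteEdges hS.1
  omega

theorem globalForcingNumber_add_le_maxAntiForcingNumber_add [Fintype V] {n : ℕ}
    (hcard : Fintype.card V = 2 * n) (hconn : G.Connected)
    (hpm : ∃ M : G.Subgraph, M.IsPerfectMatching) :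
    globalForcingNumber G + 3 * n ≤ maxAntiForcingNumber G + n ^ 2 + 2 := by
  obtain ⟨M, hM⟩ := hpm
  obtain ⟨σ, hσ, hMσ⟩ := exists_isMate hM
  obtain ⟨H, hHG, hH, hHc⟩ := exists_isUniqueMate_add_eq hσ hMσ
  obtain ⟨R, δ, x, hx, hR⟩ := exists_roots hH.1
  have hle : branchingGraph H σ R x ≤ G := fun a b h => hHG h.1
  obtain ⟨T, hBT, hTG, hT, hTconn⟩ := (hx.isRigid hH.1).exists_connected_ge hconn hle
  have h1 := globalForcingNumber_add_le hTG hT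
  have h2 := hx.three_mul_le hcard hH.1 hBT hTconn
  have h3 := hH.noSwitch.two_mul_ncard_edgeSet_add_le hcard hH.1 R hR
  have h4 := antiForcingNumber_le_max hM
  -- `k - 1 ≤ k (k - 1) / 2` for every natural number `k`
  have h5 : 2 * R.card ≤ R.card * (R.card - 1) + 2 := by
    rcases R.card with _ | _ | k
    · simp
    · simp
    · rw [Nat.add_sub_cancel]
      nlinarith
  omega

end PerfectMatchingForcing

theorem mainTheorem4 {V : Type*} [Fintype V] (G : SimpleGraph V) (n : ℕ)
    (hn : 2 ≤ n) (hcard : Fintype.card V = 2 * n) (hconn : G.Connected)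
    (hpm : ∃ M : G.Subgraph, M.IsPerfectMatching) :
    -(((n : ℝ) ^ 2 - n - 2) / 2) ≤
        (PerfectMatchingForcing.globalForcingNumber G : ℝ) -
          PerfectMatchingForcing.maxAntiForcingNumber G ∧
      (PerfectMatchingForcing.globalForcingNumber G : ℝ) -
          PerfectMatchingForcing.maxAntiForcingNumber G ≤ ((n : ℝ) - 1) * ((n : ℝ) - 2) ∧
      ((PerfectMatchingForcing.globalForcingNumber G : ℝ) -
          PerfectMatchingForcing.maxAntiForcingNumber G = -(((n : ℝ) ^ 2 - n - 2) / 2) ↔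
        n = 2) := by
  open PerfectMatchingForcing in
  have h1 := ncard_edgeSet_le_sq_add_globalForcingNumber hcard hpm
  have h2 := globalForcingNumber_add_le_maxAntiForcingNumber_add hcard hconn hpm
  have h3 := ncard_edgeSet_le_mul hcard G
  obtain ⟨M, hM, hMA⟩ := exists_antiForcingNumber_eq_max hpm
  obtain ⟨S, hS, hSc⟩ := exists_isGlobalForcingSet G
  have h4 := two_mul_antiForcingNumber_add_le hcard hM
  have h5 := antiForcingNumber_lt_two_pow hM hS
  rw [hMA] at h4 h5
  rw [hSc] at h5
  generalize globalForcingNumber G = s at *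
  generalize maxAntiForcingNumber G = A at *
  generalize G.edgeSet.ncard = m at *
  -- For `s ≤ 2` there are at most `2 ^ s` perfect matchings; for larger `s` the number `A` is at
  -- most half of `m - n`, where `m ≤ 6` if `n = 2`, and `m ≤ n ^ 2 + s` in general.
  have hlow : (n = 2 → A ≤ s) ∧ (3 ≤ n → 2 * A + n + 2 < n ^ 2 + 2 * s) := by
    refine ⟨?_, fun hn3 => ?_⟩
    · rintro rfl
      rcases Nat.lt_or_ge s 2 with hs | hs
      · interval_cases s <;> omega
      · omega
    · rcases Nat.lt_or_ge s 3 with hs | hs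
      · interval_cases s <;> nlinarith
      · omega
  have h2' : (s : ℝ) + 3 * n ≤ A + n ^ 2 + 2 := by exact_mod_cast h2
  rcases Nat.lt_or_ge n 3 with h | h
  · obtain rfl : n = 2 := by omega
    have h6 : (A : ℝ) ≤ s := by exact_mod_cast hlow.1 rfl
    norm_num at h2' ⊢
    exact ⟨hlow.1 rfl, by linarith, by linarith⟩
  · have h6 : 2 * (A : ℝ) + n + 2 < n ^ 2 + 2 * s := by exact_mod_cast hlow.2 h
    refine ⟨by linarith, by nlinarith, fun h7 => ?_, fun h7 => by omega⟩
    linarith
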